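/- **Setting.** Let $n\ge 1$, let $S=\{i_1<\dots<i_m\}\subseteq\{1,\dots,n\}$ be the set of indices of the controlled vehicles (CAVs) among $n$ vehicles following a head vehicle, and let $\alpha_1>0$, $\alpha_2>\alpha_3>0$. The state is $x=(\tilde s_1,\tilde v_1,\dots,\tilde s_n,\tilde v_n)^\top\in\mathbb R^{2n}$ (spacing and velocity errors), the control input is $u\in\mathbb R^m$ (accelerations of the CAVs), the external input is $\epsilon\in\mathbb R$ (velocity error of the head vehicle), and the output is $y=(\tilde v_1,\dots,\tilde v_n,\tilde s_{i_1},\dots,\tilde s_{i_m})^\top\in\mathbb R^{n+m}$. The linearized mixed-traffic system is $\dot x=Ax+Bu+H\epsilon$, $y=Cx$, where $A\in\mathbb R^{2n\times 2n}$ is block lower bidiagonal with $2\times2$ diagonal blocks $A_{i,1}$ ($1\le i\le n$) and subdiagonal blocks $A_{i,2}$ in block position $(i,i-1)$ ($2\le i\le n$), $$A_{i,1}=\begin{bmatrix}0&-1\\ \alpha_1&-\alpha_2\end{bmatrix},\quad A_{i,2}=\begin{bmatrix}0&1\\0&\alpha_3\end{bmatrix}\quad(i\notin S),\qquad A_{i,1}=\begin{bmatrix}0&-1\\0&0\end{bmatrix},\quad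 A_{i,2}=\begin{bmatrix}0&1\\0&0\end{bmatrix}\quad(i\in S),$$ $B=[e_{2i_1},\dots,e_{2i_m}]$, $C=[e_2,e_4,\dots,e_{2n},e_{2i_1-1},\dots,e_{2i_m-1}]^\top$ with $e_j$ the unit vectors of $\mathbb R^{2n}$, and $H=(1,\eta,0,\dots,0)^\top$ with $\eta=\alpha_3$; if $1\in S$, the value $\eta=0$ is allowed as well. For a sampling time $\Delta t>0$, the discretized system is $$x(k+1)=A_{\mathrm d}x(k)+B_{\mathrm d}u(k)+H_{\mathrm d}\epsilon(k),\qquad y(k)=Cx(k),$$ with $A_{\mathrm d}=e^{A\Delta t}$, $B_{\mathrm d}=\int_0^{\Delta t}e^{At}B\,dt$, $H_{\mathrm d}=\int_0^{\Delta t}e^{At}H\,dt$. A length-$L$ trajectory is a triple of sequences $(u,\epsilon,y)$ of length $L$ that satisfies these equations for some state sequence $x$ (with arbitrary initial state). For a vector signal $\omega=(\omega(1),\dots,\omega(T))$ and $l\le T$, let $\mathcal H_l(\omega)$ be the Hankel matrix with $l$ block rows and $T-l+1$ columns whose block in position $(a,b)$ is $\omega(a+b-1)$; $\omega$ is persistently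 exciting of order $l$ if $l\le T$ and $\mathcal H_l(\omega)$ has full row rank. **Assumptions.** Let $T_{\mathrm{ini}},N,T\in\mathbb N$ and let $(u^{\mathrm d},\epsilon^{\mathrm d},y^{\mathrm d})$ be a length-$T$ trajectory of the discretized system. Suppose that 1. $\alpha_1-\alpha_2\alpha_3+\alpha_3^2\ne0$; 2. for any two complex eigenvalues $\lambda,\mu$ of $A$ with $\operatorname{Re}(\lambda-\mu)=0$ one has $|\operatorname{Im}(\lambda-\mu)|\neq 2\pi k/\Delta t$ for all $k=1,2,\dots$; 3. the combined input $\hat u^{\mathrm d}(k)=\mathrm{col}(\epsilon^{\mathrm d}(k),u^{\mathrm d}(k))$ is persistently exciting of order $T_{\mathrm{ini}}+N+2n$. Let $U_{\mathrm p},E_{\mathrm p},Y_{\mathrm p}$ and $U_{\mathrm f},E_{\mathrm f},Y_{\mathrm f}$ consist of the first $T_{\mathrm{ini}}$ and the last $N$ block rows of $\mathcal H_{T_{\mathrm{ini}}+N}(u^{\mathrm d})$, $\mathcal H_{T_{\mathrm{ini}}+N}(\epsilon^{\mathrm d})$, $\mathcal H_{T_{\mathrm{ini}}+N}(y^{\mathrm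 d})$, respectively. **Proposition 2.** Let $u_{\mathrm{ini}},\epsilon_{\mathrm{ini}},y_{\mathrm{ini}}$ be sequences of length $T_{\mathrm{ini}}$ and $u,\epsilon,y$ sequences of length $N$, with values in the respective spaces. Their concatenation, $(u_{\mathrm{ini}},\epsilon_{\mathrm{ini}},y_{\mathrm{ini}})$ followed by $(u,\epsilon,y)$, is a length-$(T_{\mathrm{ini}}+N)$ trajectory of the discretized system if and only if there is $g\in\mathbb R^{T-T_{\mathrm{ini}}-N+1}$ with $$\begin{bmatrix}U_{\mathrm p}\\E_{\mathrm p}\\Y_{\mathrm p}\\U_{\mathrm f}\\E_{\mathrm f}\\Y_{\mathrm f}\end{bmatrix}g=\begin{bmatrix}u_{\mathrm{ini}}\\\epsilon_{\mathrm{ini}}\\y_{\mathrm{ini}}\\u\\\epsilon\\y\end{bmatrix}.\qquad(*)$$ In particular every length-$(T_{\mathrm{ini}}+N)$ trajectory lies in the range of the stacked data matrix. If moreover $T_{\mathrm{ini}}\ge 2n$, then for all $u_{\mathrm{ini}},\epsilon_{\mathrm{ini}},y_{\mathrm{ini}},u,\epsilon$ there is at most one $y$ for which $(*)$ is solvable in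 $g$. -/

import Mathlib

open scoped Matrix

noncomputable section

namespace MixedTraffic

/-- State coordinates of the `n` following vehicles, in the order `s₁, v₁, s₂, v₂, …, sₙ, vₙ`:
`(i, 0)` is the spacing error and `(i, 1)` the velocity error of vehicle `i`
(the vehicles `1, …, n` are the elements `0, …, n - 1` of `Fin n`). -/
abbrev StateIdx (n : ℕ) : Type := Fin n × Fin 2

/-- Output coordinates: the velocity errors of all vehicles, then the spacing errors of the CAVs. -/
abbrev OutIdx {n : ℕ} (S : Finset (Fin n)) : Type := Fin n ⊕ S

/-! ### The continuous-time linearized model `ẋ = A x + B u + H ε`, `y = C x` -/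

/-- Diagonal block of an HDV. -/
def blockP1 (α₁ α₂ : ℝ) : Matrix (Fin 2) (Fin 2) ℝ := !![0, -1; α₁, -α₂]

/-- Subdiagonal block of an HDV. -/
def blockP2 (α₃ : ℝ) : Matrix (Fin 2) (Fin 2) ℝ := !![0, 1; 0, α₃]

/-- Diagonal block of a CAV. -/
def blockS1 : Matrix (Fin 2) (Fin 2) ℝ := !![0, -1; 0, 0]

/-- Subdiagonal block of a CAV. -/
def blockS2 : Matrix (Fin 2) (Fin 2) ℝ := !![0, 1; 0, 0]

/-- The block lower-bidiagonal system matrix; `S` is the set of CAVs. -/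
def matA {n : ℕ} (S : Finset (Fin n)) (α₁ α₂ α₃ : ℝ) : Matrix (StateIdx n) (StateIdx n) ℝ :=
  Matrix.of fun p q =>
    if q.1 = p.1 then (if p.1 ∈ S then blockS1 else blockP1 α₁ α₂) p.2 q.2
    else if (q.1 : ℕ) + 1 = (p.1 : ℕ) then (if p.1 ∈ S then blockS2 else blockP2 α₃) p.2 q.2
    else 0

/-- The control input of CAV `i` is its acceleration. -/
def matB {n : ℕ} (S : Finset (Fin n)) : Matrix (StateIdx n) S ℝ :=
  Matrix.of fun p i => if p = ((i : Fin n), (1 : Fin 2)) then 1 else 0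

/-- The column `H = (1, η, 0, …, 0)ᵀ` through which the velocity error of the head vehicle enters
the dynamics of the first following vehicle. -/
def matH (n : ℕ) (η : ℝ) : Matrix (StateIdx n) (Fin 1) ℝ :=
  Matrix.of fun p _ => if (p.1 : ℕ) = 0 then (![1, η] : Fin 2 → ℝ) p.2 else 0

/-- The output matrix. -/
def matC {n : ℕ} (S : Finset (Fin n)) : Matrix (OutIdx S) (StateIdx n) ℝ :=
  Matrix.of fun o q =>
    Sum.elim (fun i : Fin n => if q = (i, (1 : Fin 2)) then 1 else 0)
      (fun i : S => if q = ((i : Fin n), (0 : Fin 2)) then 1 else 0) o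

/-! ### Discretization with sampling time `Δt` -/

/-- `e^{A Δt}`. -/
def discState {ι : Type} [Fintype ι] [DecidableEq ι] (A : Matrix ι ι ℝ) (Δt : ℝ) :
    Matrix ι ι ℝ :=
  NormedSpace.exp (Δt • A)

/-- `∫₀^{Δt} e^{A t} B dt`, entrywise. -/
def discInput {ι κ : Type} [Fintype ι] [DecidableEq ι] (A : Matrix ι ι ℝ) (B : Matrix ι κ ℝ)
    (Δt : ℝ) : Matrix ι κ ℝ :=
  Matrix.of fun i j => ∫ t in (0 : ℝ)..Δt, (NormedSpace.exp (t • A) * B) i j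

/-- The sampling-time assumption: complex eigenvalues of `A` with the same real part do not have
imaginary parts that differ by a nonzero integer multiple of `2π / Δt`. -/
def SamplingCondition {ι : Type} [Fintype ι] [DecidableEq ι] (A : Matrix ι ι ℝ) (Δt : ℝ) :
    Prop :=
  ∀ z ∈ spectrum ℂ (A.map (algebraMap ℝ ℂ)), ∀ w ∈ spectrum ℂ (A.map (algebraMap ℝ ℂ)),
    (z - w).re = 0 → ∀ k : ℕ, 1 ≤ k → |(z - w).im| ≠ 2 * Real.pi * k / Δt

/-- `(u, ε, y)` is a length-`L` trajectory of
`x(k+1) = A x(k) + B u(k) + H ε(k)`, `y(k) = C x(k)`, for some state sequence `x`. -/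
def IsTrajectory {ι κ τ o : Type} [Fintype ι] [Fintype κ] [Fintype τ]
    (A : Matrix ι ι ℝ) (B : Matrix ι κ ℝ) (H : Matrix ι τ ℝ) (C : Matrix o ι ℝ) {L : ℕ}
    (u : Fin L → κ → ℝ) (ε : Fin L → τ → ℝ) (y : Fin L → o → ℝ) : Prop :=
  ∃ x : ℕ → ι → ℝ, ∀ k : Fin L,
    x (k + 1) = A *ᵥ x k + B *ᵥ u k + H *ᵥ ε k ∧ y k = C *ᵥ x k

/-- Length-`L` trajectories of the discretized mixed traffic system. -/
def IsTrafficTrajectory {n : ℕ} (S : Finset (Fin n)) (α₁ α₂ α₃ η Δt : ℝ) {L : ℕ}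
    (u : Fin L → S → ℝ) (ε : Fin L → Fin 1 → ℝ) (y : Fin L → OutIdx S → ℝ) : Prop :=
  IsTrajectory (discState (matA S α₁ α₂ α₃) Δt)
    (discInput (matA S α₁ α₂ α₃) (matB S) Δt)
    (discInput (matA S α₁ α₂ α₃) (matH n η) Δt) (matC S) u ε y

/-! ### Hankel matrices -/

/-- `col(w(1), …, w(L))`. -/
def col {L : ℕ} {κ : Type} (w : Fin L → κ → ℝ) : Fin L × κ → ℝ := fun p => w p.1 p.2

/-- Hankel matrix of order `L` of a signal of length `T`: it has `L` block rows and, for `L ≤ T`,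
`T - L + 1` columns. -/
def hankel {T : ℕ} {κ : Type} (L : ℕ) (w : Fin T → κ → ℝ) :
    Matrix (Fin L × κ) (Fin (T + 1 - L)) ℝ :=
  Matrix.of fun p j => w ⟨p.1 + j, by have := p.1.2; have := j.2; omega⟩ p.2

/-- Persistent excitation of order `l`: `l ≤ T` and the Hankel matrix has full row rank. -/
def PersistentlyExciting {T : ℕ} {κ : Type} [Fintype κ] (l : ℕ) (w : Fin T → κ → ℝ) : Prop :=
  l ≤ T ∧ (hankel l w).rank = Fintype.card (Fin l × κ)

/-- The combined input `û(k) = col(ε(k), u(k))`. -/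
def combinedInput {T : ℕ} {κ : Type} (u : Fin T → κ → ℝ) (ε : Fin T → Fin 1 → ℝ) :
    Fin T → Fin 1 ⊕ κ → ℝ :=
  fun k => Sum.elim (ε k) (u k)

/-- The first `Tini` block rows of the Hankel matrix of order `Tini + N` (past data). -/
def hankelPast {T : ℕ} {κ : Type} (Tini N : ℕ) (w : Fin T → κ → ℝ) :
    Matrix (Fin Tini × κ) (Fin (T + 1 - (Tini + N))) ℝ :=
  (hankel (Tini + N) w).submatrix (fun p => (Fin.castAdd N p.1, p.2)) id

/-- The last `N` block rows of the Hankel matrix of order `Tini + N` (future data). -/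
def hankelFuture {T : ℕ} {κ : Type} (Tini N : ℕ) (w : Fin T → κ → ℝ) :
    Matrix (Fin N × κ) (Fin (T + 1 - (Tini + N))) ℝ :=
  (hankel (Tini + N) w).submatrix (fun p => (Fin.natAdd Tini p.1, p.2)) id

/-- `col(u_ini, ε_ini, y_ini, u, ε, y)` is in the range of the stacked data matrix
`col(U_p, E_p, Y_p, U_f, E_f, Y_f)`. -/
def InDataRange {T Tini N : ℕ} {κ o : Type}
    (ud : Fin T → κ → ℝ) (εd : Fin T → Fin 1 → ℝ) (yd : Fin T → o → ℝ)
    (uini : Fin Tini → κ → ℝ) (εini : Fin Tini → Fin 1 → ℝ) (yini : Fin Tini → o → ℝ)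
    (u : Fin N → κ → ℝ) (ε : Fin N → Fin 1 → ℝ) (y : Fin N → o → ℝ) : Prop :=
  ∃ g : Fin (T + 1 - (Tini + N)) → ℝ,
    hankelPast Tini N ud *ᵥ g = col uini ∧
    hankelPast Tini N εd *ᵥ g = col εini ∧
    hankelPast Tini N yd *ᵥ g = col yini ∧
    hankelFuture Tini N ud *ᵥ g = col u ∧
    hankelFuture Tini N εd *ᵥ g = col ε ∧
    hankelFuture Tini N yd *ᵥ g = col y

end MixedTraffic

end

open scoped Matrix

noncomputable section

namespace MixedTraffic

/-! The equivalence is Willems' fundamental lemma with `col(ε, u)` as the input, so the main point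
is that the sampled pair is controllable.

Given controllability, persistent excitation makes the matrix whose columns are (state at time `j`,
input window starting at `j`) surjective (`eq_zero_of_window_relation`). Any initial state and any
input sequence are thus a combination of columns, and by linearity the same coefficients `g`
reproduce the outputs. Conversely, combinations of windows of a trajectory are trajectories.

Controllability is proved in two stages. In continuous time the Hautus test is run vehicle by
vehicle down the platoon (`matA_hautus`); the condition on the `αᵢ` excludes the one eigenvalue for
which the propagation could fail. Sampling preserves controllability (`controllable_of_sampling`):
the sampling condition makes the exponential injective on the spectrum, so left eigenvectors of
`e^{AΔt}` are left eigenvectors of `A`, and on these the sampled input matrix is a nonzero scalar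
multiple of the continuous one.

Uniqueness of the output needs only Cayley–Hamilton: a free response that is invisible for `2n`
steps stays invisible. -/

/-! ### Consequences of the Cayley–Hamilton theorem -/

/-- A linear functional that kills the powers `A ^ k`, `k < card ι`, kills all powers of `A`. -/
theorem map_pow_eq_zero_of_lt_card {ι K M : Type*} [Fintype ι] [DecidableEq ι] [Field K]
    [AddCommGroup M] [Module K M] (A : Matrix ι ι K) (F : Matrix ι ι K →ₗ[K] M)
    (h : ∀ k < Fintype.card ι, F (A ^ k) = 0) (k : ℕ) : F (A ^ k) = 0 := by
  induction k using Nat.strong_induction_on with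
  | _ k ih =>
    rcases lt_or_ge k (Fintype.card ι) with hk | hk
    · exact h k hk
    · have hCH := A.aeval_self_charpoly
      rw [Polynomial.aeval_eq_sum_range, A.charpoly_natDegree_eq_dim, Finset.sum_range_succ] at hCH
      have hlead : A.charpoly.coeff (Fintype.card ι) = 1 := by
        rw [← A.charpoly_natDegree_eq_dim]
        exact A.charpoly_monic
      rw [hlead, one_smul] at hCH
      have hpow : A ^ k = -∑ i ∈ Finset.range (Fintype.card ι),
          A.charpoly.coeff i • A ^ (k - Fintype.card ι + i) := by
        have : A ^ k = A ^ (k - Fintype.card ι) * A ^ Fintype.card ι := by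
          rw [← pow_add, Nat.sub_add_cancel hk]
        rw [this, eq_neg_of_add_eq_zero_right hCH, mul_neg, Finset.mul_sum]
        simp [pow_add]
      rw [hpow, map_neg, map_sum, neg_eq_zero]
      refine Finset.sum_eq_zero fun i hi => ?_
      rw [map_smul, ih _ (by have := Finset.mem_range.1 hi; omega), smul_zero]

/-- If the free response of the output vanishes for `card ι` steps, it vanishes forever. -/
theorem output_eq_zero_of_lt_card {ι o K : Type*} [Fintype ι] [DecidableEq ι] [Field K]
    (A : Matrix ι ι K) (C : Matrix o ι K) (x : ι → K)
    (h : ∀ k < Fintype.card ι, C *ᵥ (A ^ k *ᵥ x) = 0) (k : ℕ) : C *ᵥ (A ^ k *ᵥ x) = 0 := by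
  let F : Matrix ι ι K →ₗ[K] (o → K) :=
    { toFun := fun M => C *ᵥ (M *ᵥ x)
      map_add' := fun M M' => by rw [Matrix.add_mulVec, Matrix.mulVec_add]
      map_smul' := fun c M => by simp [Matrix.smul_mulVec, Matrix.mulVec_smul] }
  exact map_pow_eq_zero_of_lt_card A F h k

/-- If a covector annihilates the first `card ι` blocks of the controllability matrix, it
annihilates all of them. -/
theorem vecMul_pow_eq_zero_of_lt_card {ι κ K : Type*} [Fintype ι] [DecidableEq ι] [Field K]
    (A : Matrix ι ι K) (G : Matrix ι κ K) (ξ : ι → K)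
    (h : ∀ k < Fintype.card ι, (ξ ᵥ* A ^ k) ᵥ* G = 0) (k : ℕ) : (ξ ᵥ* A ^ k) ᵥ* G = 0 := by
  let F : Matrix ι ι K →ₗ[K] (κ → K) :=
    { toFun := fun M => (ξ ᵥ* M) ᵥ* G
      map_add' := fun M M' => by rw [Matrix.vecMul_add, Matrix.add_vecMul]
      map_smul' := fun c M => by simp [Matrix.vecMul_smul, Matrix.smul_vecMul] }
  exact map_pow_eq_zero_of_lt_card A F h k

/-! ### The fundamental lemma -/

/-- A sequence that satisfies a monic linear recurrence backwards in time and vanishes eventually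
is zero. -/
theorem eq_zero_of_backward_recurrence {M : Type*} [AddCommGroup M] [Module ℝ M] (d R : ℕ)
    (c : ℕ → ℝ) (hc : c d = 1) (w : ℕ → M) (hw : ∀ m, R ≤ m → w m = 0)
    (hrec : ∀ m < R, ∑ i ∈ Finset.range (d + 1), c i • w (m + (d - i)) = 0) (m : ℕ) : w m = 0 := by
  suffices H : ∀ s m, R ≤ m + s → w m = 0 from H R m (by omega)
  intro s
  induction s with
  | zero => exact fun m hm => hw m hm
  | succ s ih =>
    intro m hm
    rcases le_or_gt R m with h | h
    · exact hw m h
    · have := hrec m h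
      rw [Finset.sum_range_succ, Finset.sum_eq_zero, hc] at this
      · simpa using this
      · intro i hi
        rw [ih _ (by have := Finset.mem_range.1 hi; omega), smul_zero]

section Fundamental

variable {ι κ : Type*} [Fintype ι] [DecidableEq ι] [Fintype κ]

/-- Variation of constants, tested against a covector. -/
theorem dotProduct_state_add (A : Matrix ι ι ℝ) (G : Matrix ι κ ℝ) (x : ℕ → ι → ℝ)
    (w : ℕ → κ → ℝ) {T : ℕ} (hx : ∀ k < T, x (k + 1) = A *ᵥ x k + G *ᵥ w k) (i : ℕ) :
    ∀ (ξ : ι → ℝ) (j : ℕ), j + i ≤ T → ξ ⬝ᵥ x (j + i) = (ξ ᵥ* A ^ i) ⬝ᵥ x j +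
      ∑ m ∈ Finset.range i, ((ξ ᵥ* A ^ (i - 1 - m)) ᵥ* G) ⬝ᵥ w (j + m) := by
  induction i with
  | zero => intro ξ j _; simp
  | succ i ih =>
    intro ξ j hj
    rw [← add_assoc, hx _ (by omega), dotProduct_add, Matrix.dotProduct_mulVec,
      Matrix.dotProduct_mulVec, ih _ _ (by omega), Finset.sum_range_succ, Matrix.vecMul_vecMul,
      ← pow_succ', add_assoc]
    simp only [Nat.add_sub_cancel, Nat.sub_self, pow_zero, Matrix.vecMul_one]
    congr 2
    refine Finset.sum_congr rfl fun m hm => ?_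
    have hm := Finset.mem_range.1 hm
    rw [Matrix.vecMul_vecMul ξ, ← pow_succ', show i - 1 - m + 1 = i - m by omega]

/-- Under persistent excitation of order `L + card ι` and controllability, the initial state and
the input windows of length `L` of a trajectory satisfy no nontrivial linear relation. -/
theorem eq_zero_of_window_relation (A : Matrix ι ι ℝ) (G : Matrix ι κ ℝ)
    (hctrl : ∀ ξ : ι → ℝ, (∀ k < Fintype.card ι, (ξ ᵥ* A ^ k) ᵥ* G = 0) → ξ = 0)
    (x : ℕ → ι → ℝ) (w : ℕ → κ → ℝ) {T L : ℕ}
    (hx : ∀ k < T, x (k + 1) = A *ᵥ x k + G *ᵥ w k)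
    (hexc : ∀ φ : ℕ → κ → ℝ,
      (∀ j, j + (L + Fintype.card ι) ≤ T →
        ∑ m ∈ Finset.range (L + Fintype.card ι), φ m ⬝ᵥ w (j + m) = 0) →
      ∀ m < L + Fintype.card ι, φ m = 0)
    (ξ : ι → ℝ) (θ : ℕ → κ → ℝ)
    (hrel : ∀ j, j + L ≤ T → ξ ⬝ᵥ x j + ∑ a ∈ Finset.range L, θ a ⬝ᵥ w (j + a) = 0) :
    ξ = 0 ∧ ∀ a < L, θ a = 0 := by
  set d := Fintype.card ι with hd
  -- Input coefficients of the relation at time `j + d`, once the state there is expressed through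
  -- the state at `j`: first the terms from variation of constants, then `θ`, then zeros.
  let ω : ℕ → κ → ℝ := fun s => if s < d then (ξ ᵥ* A ^ (d - 1 - s)) ᵥ* G else
    if s < L + d then θ (s - d) else 0
  have hω₁ : ∀ s < d, ω s = (ξ ᵥ* A ^ (d - 1 - s)) ᵥ* G := fun s hs => if_pos hs
  have hω₂ : ∀ a < L, ω (d + a) = θ a := fun a ha => by
    simp only [ω]
    rw [if_neg (by omega), if_pos (by omega), Nat.add_sub_cancel_left]
  have hω₃ : ∀ s, L + d ≤ s → ω s = 0 := fun s hs => by
    simp only [ω]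
    rw [if_neg (by omega), if_neg (by omega)]
  -- The relation at time `j + i`, pulled back to the state at `j`, has the same coefficients `ω`
  -- shifted by `d - i`. Padding with zeros puts all these relations on one window of length `L +
  -- d`.
  have hwin : ∀ i ≤ d, ∀ j, j + (L + d) ≤ T → (ξ ᵥ* A ^ i) ⬝ᵥ x j +
      ∑ m ∈ Finset.range (L + d), ω (m + (d - i)) ⬝ᵥ w (j + m) = 0 := by
    intro i hi j hj
    rw [← hrel (j + i) (by omega), dotProduct_state_add A G x w hx i ξ j (by omega), add_assoc,
      show L + d = i + (L + (d - i)) by omega, Finset.sum_range_add, Finset.sum_range_add]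
    congr 2
    · refine Finset.sum_congr rfl fun m hm => ?_
      have hm := Finset.mem_range.1 hm
      rw [hω₁ _ (by omega), show d - 1 - (m + (d - i)) = i - 1 - m by omega]
    · rw [Finset.sum_eq_zero (s := Finset.range (d - i)), add_zero]
      · refine Finset.sum_congr rfl fun m hm => ?_
        rw [show i + m + (d - i) = d + m by omega, hω₂ _ (Finset.mem_range.1 hm), add_assoc]
      · intro m _
        rw [hω₃ _ (by omega), zero_dotProduct]
  have hlead : A.charpoly.coeff d = 1 := by
    rw [hd, ← A.charpoly_natDegree_eq_dim]
    exact A.charpoly_monic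
  have hCH : ∑ i ∈ Finset.range (d + 1), A.charpoly.coeff i • A ^ i = 0 := by
    have := A.aeval_self_charpoly
    rwa [Polynomial.aeval_eq_sum_range, A.charpoly_natDegree_eq_dim] at this
  -- Combining the shifted relations with the coefficients of the characteristic polynomial cancels
  -- the state. Excitation then kills the combined input coefficients, which is a recurrence for
  -- `ω`; monicity lets it be solved backwards from the zero tail.
  have hω : ∀ s, ω s = 0 := by
    refine eq_zero_of_backward_recurrence d (L + d) A.charpoly.coeff hlead ω hω₃ ?_
    refine hexc (fun m => ∑ i ∈ Finset.range (d + 1), A.charpoly.coeff i • ω (m + (d - i))) ?_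
    intro j hj
    have hstate : ∑ i ∈ Finset.range (d + 1),
        A.charpoly.coeff i * ((ξ ᵥ* A ^ i) ⬝ᵥ x j) = 0 := by
      have : ξ ⬝ᵥ ((∑ i ∈ Finset.range (d + 1), A.charpoly.coeff i • A ^ i) *ᵥ x j) = 0 := by
        rw [hCH, Matrix.zero_mulVec, dotProduct_zero]
      rw [← this, Matrix.sum_mulVec, dotProduct_sum]
      refine Finset.sum_congr rfl fun i _ => ?_
      rw [Matrix.smul_mulVec, dotProduct_smul, Matrix.dotProduct_mulVec, smul_eq_mul]
    have hsum : ∑ i ∈ Finset.range (d + 1), A.charpoly.coeff i * ((ξ ᵥ* A ^ i) ⬝ᵥ x j +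
        ∑ m ∈ Finset.range (L + d), ω (m + (d - i)) ⬝ᵥ w (j + m)) = 0 :=
      Finset.sum_eq_zero fun i hi => by
        rw [hwin i (by have := Finset.mem_range.1 hi; omega) j hj, mul_zero]
    simp only [mul_add, Finset.sum_add_distrib] at hsum
    rw [hstate, zero_add] at hsum
    rw [← hsum]
    simp only [sum_dotProduct, smul_dotProduct, smul_eq_mul, Finset.mul_sum]
    exact Finset.sum_comm
  refine ⟨hctrl ξ fun k hk => ?_, fun a ha => ?_⟩
  · have := hω₁ (d - 1 - k) (by omega)
    rw [hω, show d - 1 - (d - 1 - k) = k by omega] at this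
    exact this.symm
  · rw [← hω₂ a ha, hω]

end Fundamental

/-! ### Row rank -/

/-- A matrix of full row rank has trivial left kernel. -/
theorem vecMul_eq_zero_of_rank_eq_card {R Q : Type*} [Fintype R] [Fintype Q] {M : Matrix R Q ℝ}
    (h : M.rank = Fintype.card R) {v : R → ℝ} (hv : v ᵥ* M = 0) : v = 0 := by
  have hr : Mᵀ.rank + Module.finrank ℝ (LinearMap.ker Mᵀ.mulVecLin) = Fintype.card R := by
    have := LinearMap.finrank_range_add_finrank_ker Mᵀ.mulVecLin
    rwa [Module.finrank_pi] at this
  rw [Matrix.rank_transpose, h, Nat.add_eq_left, Submodule.finrank_eq_zero] at hr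
  have : v ∈ LinearMap.ker Mᵀ.mulVecLin := by
    simpa [Matrix.mulVec_transpose] using hv
  rwa [hr, Submodule.mem_bot] at this

/-- A matrix with trivial left kernel is surjective. -/
theorem exists_mulVec_eq_of_vecMul_injective {R Q : Type*} [Fintype R] [Fintype Q]
    {M : Matrix R Q ℝ} (h : ∀ v : R → ℝ, v ᵥ* M = 0 → v = 0) (b : R → ℝ) :
    ∃ g : Q → ℝ, M *ᵥ g = b := by
  have hk : LinearMap.ker Mᵀ.mulVecLin = ⊥ := by
    rw [LinearMap.ker_eq_bot']
    intro v hv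
    exact h v (by simpa [Matrix.mulVec_transpose] using hv)
  have hr := LinearMap.finrank_range_add_finrank_ker Mᵀ.mulVecLin
  rw [hk, finrank_bot, add_zero] at hr
  have hM : Module.finrank ℝ (LinearMap.range M.mulVecLin) = Module.finrank ℝ (R → ℝ) := by
    rw [← hr]
    exact M.rank_transpose.symm
  have := Submodule.eq_top_of_finrank_eq hM
  exact LinearMap.range_eq_top.1 this b

/-! ### Trajectories and Hankel matrices -/

theorem hankel_mulVec_apply {T L : ℕ} {κ : Type} (w : Fin T → κ → ℝ) (w' : ℕ → κ → ℝ)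
    (hw : ∀ k : Fin T, w' k = w k) (g : Fin (T + 1 - L) → ℝ) (a : Fin L) (c : κ) :
    (hankel L w *ᵥ g) (a, c) = ∑ j : Fin (T + 1 - L), g j * w' (j + a) c := by
  simp only [Matrix.mulVec, dotProduct, hankel, Matrix.of_apply]
  refine Finset.sum_congr rfl fun j _ => ?_
  rw [mul_comm, ← hw]
  simp only [add_comm]

theorem hankel_mulVec_eq_col_iff {T L : ℕ} {κ : Type} (w : Fin T → κ → ℝ) (w' : ℕ → κ → ℝ)
    (hw : ∀ k : Fin T, w' k = w k) (g : Fin (T + 1 - L) → ℝ) (v : Fin L → κ → ℝ) :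
    hankel L w *ᵥ g = col v ↔ ∀ a : Fin L, ∑ j : Fin (T + 1 - L), g j • w' (j + a) = v a := by
  simp only [funext_iff, Prod.forall, hankel_mulVec_apply w w' hw, col, Finset.sum_apply,
    Pi.smul_apply, smul_eq_mul]

/-- Persistent excitation of order `l` excludes linear relations between the entries of all windows
of length `l`. -/
theorem PersistentlyExciting.eq_zero {T l : ℕ} {κ : Type} [Fintype κ] {w : Fin T → κ → ℝ}
    (h : PersistentlyExciting l w) (w' : ℕ → κ → ℝ) (hw : ∀ k : Fin T, w' k = w k)
    (φ : ℕ → κ → ℝ)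
    (hφ : ∀ j, j + l ≤ T → ∑ m ∈ Finset.range l, φ m ⬝ᵥ w' (j + m) = 0) :
    ∀ m < l, φ m = 0 := by
  have hker : (fun p : Fin l × κ => φ p.1 p.2) ᵥ* hankel l w = 0 := by
    funext j
    have := hφ j (by have := j.2; have := h.1; omega)
    rw [Finset.sum_range] at this
    simp only [Matrix.vecMul, dotProduct, hankel, Matrix.of_apply, Fintype.sum_prod_type,
      Pi.zero_apply]
    rw [← this]
    refine Finset.sum_congr rfl fun m _ => Finset.sum_congr rfl fun c _ => ?_
    rw [← hw]
    simp only [add_comm]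
  have := vecMul_eq_zero_of_rank_eq_card h.2 hker
  intro m hm
  funext c
  exact congrFun this (⟨m, hm⟩, c)

/-- **Fundamental lemma** for a controllable system with inputs `u` and `ε`: the trajectories of
length `L` are the combinations of the windows of one persistently exciting trajectory. -/
theorem isTrajectory_iff_exists_hankel {ι κ o : Type} [Fintype ι] [DecidableEq ι] [Fintype κ]
    (A : Matrix ι ι ℝ) (B : Matrix ι κ ℝ) (H : Matrix ι (Fin 1) ℝ) (C : Matrix o ι ℝ)
    (hctrl : ∀ ξ : ι → ℝ,
      (∀ k < Fintype.card ι, (ξ ᵥ* A ^ k) ᵥ* Matrix.fromCols H B = 0) → ξ = 0)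
    {T L : ℕ} {ud : Fin T → κ → ℝ} {εd : Fin T → Fin 1 → ℝ} {yd : Fin T → o → ℝ}
    (hdata : IsTrajectory A B H C ud εd yd)
    (hexc : PersistentlyExciting (L + Fintype.card ι) (combinedInput ud εd))
    (u : Fin L → κ → ℝ) (ε : Fin L → Fin 1 → ℝ) (y : Fin L → o → ℝ) :
    IsTrajectory A B H C u ε y ↔ ∃ g : Fin (T + 1 - L) → ℝ,
      hankel L ud *ᵥ g = col u ∧ hankel L εd *ᵥ g = col ε ∧ hankel L yd *ᵥ g = col y := by
  obtain ⟨x, hx⟩ := hdata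
  have hLT : L ≤ T := (Nat.le_add_right _ _).trans hexc.1
  let ud' : ℕ → κ → ℝ := fun k => if h : k < T then ud ⟨k, h⟩ else 0
  let εd' : ℕ → Fin 1 → ℝ := fun k => if h : k < T then εd ⟨k, h⟩ else 0
  let yd' : ℕ → o → ℝ := fun k => C *ᵥ x k
  have hud : ∀ k : Fin T, ud' k = ud k := fun k => by simp [ud']
  have hεd : ∀ k : Fin T, εd' k = εd k := fun k => by simp [εd']
  have hyd : ∀ k : Fin T, yd' k = yd k := fun k => (hx k).2.symm
  have hx' : ∀ k < T, x (k + 1) = A *ᵥ x k + B *ᵥ ud' k + H *ᵥ εd' k := fun k hk => by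
    simpa [ud', εd', hk] using (hx ⟨k, hk⟩).1
  simp only [hankel_mulVec_eq_col_iff ud ud' hud, hankel_mulVec_eq_col_iff εd εd' hεd,
    hankel_mulVec_eq_col_iff yd yd' hyd]
  have hstep : ∀ (g : Fin (T + 1 - L) → ℝ), ∀ k < L, ∑ j, g j • x (j + (k + 1)) =
      A *ᵥ (∑ j, g j • x (j + k)) + B *ᵥ (∑ j, g j • ud' (j + k)) +
        H *ᵥ (∑ j, g j • εd' (j + k)) := by
    intro g k hk
    simp only [Matrix.mulVec_sum, Matrix.mulVec_smul, ← Finset.sum_add_distrib, ← smul_add]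
    refine Finset.sum_congr rfl fun j _ => ?_
    rw [← add_assoc, hx' _ (by have := j.2; omega)]
  constructor
  · rintro ⟨z, hz⟩
    let w : ℕ → Fin 1 ⊕ κ → ℝ := fun k => Sum.elim (εd' k) (ud' k)
    have hw : ∀ k : Fin T, w k = combinedInput ud εd k := fun k => by
      simp only [w, combinedInput, hud, hεd]
    have hxw : ∀ k < T, x (k + 1) = A *ᵥ x k + Matrix.fromCols H B *ᵥ w k := fun k hk => by
      rw [hx' k hk, Matrix.fromCols_mulVec_sumElim]
      abel
    -- A left kernel vector of `M` is exactly a linear relation between initial state and input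
    -- window, so surjectivity yields one `g` matching `z 0`, `u` and `ε` together.
    let M : Matrix (ι ⊕ Fin L × (Fin 1 ⊕ κ)) (Fin (T + 1 - L)) ℝ :=
      Matrix.of fun r j => Sum.elim (x j) (fun p => w (j + p.1) p.2) r
    have hM : ∀ v, v ᵥ* M = 0 → v = 0 := by
      intro v hv
      let θ : ℕ → Fin 1 ⊕ κ → ℝ := fun a c => if h : a < L then v (.inr (⟨a, h⟩, c)) else 0
      have := eq_zero_of_window_relation A (Matrix.fromCols H B) hctrl x w hxw
        (fun φ hφ => hexc.eq_zero w hw φ hφ) (fun i => v (.inl i)) θ (L := L) ?_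
      · funext r
        rcases r with i | ⟨a, c⟩
        · exact congrFun this.1 i
        · simpa [θ] using congrFun (this.2 a a.2) c
      · intro j hj
        have hj := congrFun hv ⟨j, by omega⟩
        simp only [Matrix.vecMul, dotProduct, Fintype.sum_sum_type, Fintype.sum_prod_type, M,
          Matrix.of_apply, Sum.elim_inl, Sum.elim_inr, Pi.zero_apply] at hj
        rw [← hj, Finset.sum_range]
        simp only [dotProduct, Fintype.sum_sum_type]
        simp [θ]
    obtain ⟨g, hg⟩ := exists_mulVec_eq_of_vecMul_injective hM
      (Sum.elim (z 0) fun p => Sum.elim (ε p.1) (u p.1) p.2)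
    have hgx : ∑ j, g j • x j = z 0 := by
      funext i
      have := congrFun hg (.inl i)
      simp only [Matrix.mulVec, dotProduct, M, Matrix.of_apply, Sum.elim_inl] at this
      simp only [← this, Finset.sum_apply, Pi.smul_apply, smul_eq_mul, mul_comm]
    have hgu : ∀ a : Fin L, ∑ j, g j • ud' (j + a) = u a := by
      intro a
      funext c
      have := congrFun hg (.inr (a, .inr c))
      simp only [Matrix.mulVec, dotProduct, M, Matrix.of_apply, Sum.elim_inr, w] at this
      simp only [← this, Finset.sum_apply, Pi.smul_apply, smul_eq_mul, mul_comm]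
    have hgε : ∀ a : Fin L, ∑ j, g j • εd' (j + a) = ε a := by
      intro a
      funext c
      have := congrFun hg (.inr (a, .inl c))
      simp only [Matrix.mulVec, dotProduct, M, Matrix.of_apply, Sum.elim_inr, Sum.elim_inl, w]
        at this
      simp only [← this, Finset.sum_apply, Pi.smul_apply, smul_eq_mul, mul_comm]
    have hgz : ∀ k ≤ L, ∑ j, g j • x (j + k) = z k := by
      intro k
      induction k with
      | zero => intro _; simpa using hgx
      | succ k ih =>
        intro hk
        rw [hstep g k hk, ih (by omega), hgu ⟨k, hk⟩, hgε ⟨k, hk⟩]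
        exact (hz ⟨k, hk⟩).1.symm
    refine ⟨g, hgu, hgε, fun a => ?_⟩
    rw [(hz a).2, ← hgz a a.2.le]
    simp only [yd', Matrix.mulVec_sum, Matrix.mulVec_smul]
  · rintro ⟨g, hgu, hgε, hgy⟩
    refine ⟨fun k => ∑ j, g j • x (j + k), fun k => ⟨?_, ?_⟩⟩
    · simpa only [hgu, hgε] using hstep g k k.2
    · rw [← hgy]
      simp only [yd', Matrix.mulVec_sum, Matrix.mulVec_smul]

theorem hankelPast_future_mulVec_iff {T Tini N : ℕ} {κ : Type} (w : Fin T → κ → ℝ)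
    (g : Fin (T + 1 - (Tini + N)) → ℝ) (v : Fin Tini → κ → ℝ) (v' : Fin N → κ → ℝ) :
    hankel (Tini + N) w *ᵥ g = col (Fin.append v v') ↔
      hankelPast Tini N w *ᵥ g = col v ∧ hankelFuture Tini N w *ᵥ g = col v' := by
  constructor
  · intro h
    refine ⟨funext fun p => ?_, funext fun p => ?_⟩
    · have := congrFun h (Fin.castAdd N p.1, p.2)
      simp only [col, Fin.append_left] at this
      exact this
    · have := congrFun h (Fin.natAdd Tini p.1, p.2)
      simp only [col, Fin.append_right] at this
      exact this
  · rintro ⟨h₁, h₂⟩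
    funext ⟨a, c⟩
    refine Fin.addCases (fun a => ?_) (fun a => ?_) a
    · have := congrFun h₁ (a, c)
      simp only [col, Fin.append_left] at this ⊢
      exact this
    · have := congrFun h₂ (a, c)
      simp only [col, Fin.append_right] at this ⊢
      exact this

theorem inDataRange_iff {T Tini N : ℕ} {κ o : Type}
    (ud : Fin T → κ → ℝ) (εd : Fin T → Fin 1 → ℝ) (yd : Fin T → o → ℝ)
    (uini : Fin Tini → κ → ℝ) (εini : Fin Tini → Fin 1 → ℝ) (yini : Fin Tini → o → ℝ)
    (u : Fin N → κ → ℝ) (ε : Fin N → Fin 1 → ℝ) (y : Fin N → o → ℝ) :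
    InDataRange ud εd yd uini εini yini u ε y ↔ ∃ g : Fin (T + 1 - (Tini + N)) → ℝ,
      hankel (Tini + N) ud *ᵥ g = col (Fin.append uini u) ∧
      hankel (Tini + N) εd *ᵥ g = col (Fin.append εini ε) ∧
      hankel (Tini + N) yd *ᵥ g = col (Fin.append yini y) := by
  simp only [hankelPast_future_mulVec_iff, InDataRange]
  exact exists_congr fun g => by tauto

/-- If the past of a trajectory is at least as long as the state dimension, the past and the future
inputs determine the future outputs. -/
theorem IsTrajectory.future_output_unique {ι κ τ o : Type} [Fintype ι] [DecidableEq ι] [Fintype κ]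
    [Fintype τ] {A : Matrix ι ι ℝ} {B : Matrix ι κ ℝ} {H : Matrix ι τ ℝ} {C : Matrix o ι ℝ}
    {Tini N : ℕ} (hT : Fintype.card ι ≤ Tini)
    {u : Fin (Tini + N) → κ → ℝ} {ε : Fin (Tini + N) → τ → ℝ}
    {yini : Fin Tini → o → ℝ} {y y' : Fin N → o → ℝ}
    (h : IsTrajectory A B H C u ε (Fin.append yini y))
    (h' : IsTrajectory A B H C u ε (Fin.append yini y')) : y = y' := by
  obtain ⟨x, hx⟩ := h
  obtain ⟨x', hx'⟩ := h'
  -- With equal inputs, the difference of the two state sequences is a free response.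
  have hdiff : ∀ k ≤ Tini + N, x k - x' k = A ^ k *ᵥ (x 0 - x' 0) := by
    intro k
    induction k with
    | zero => intro _; simp
    | succ k ih =>
      intro hk
      have h₁ := (hx ⟨k, hk⟩).1
      have h₂ := (hx' ⟨k, hk⟩).1
      simp only at h₁ h₂
      rw [pow_succ', ← Matrix.mulVec_mulVec, ← ih (by omega), h₁, h₂, Matrix.mulVec_sub]
      abel
  have hout := output_eq_zero_of_lt_card A C (x 0 - x' 0) fun k hk => by
    have h₁ := (hx (Fin.castAdd N ⟨k, hk.trans_le hT⟩)).2
    have h₂ := (hx' (Fin.castAdd N ⟨k, hk.trans_le hT⟩)).2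
    simp only [Fin.append_left, Fin.val_castAdd] at h₁ h₂
    rw [← hdiff k (by omega), Matrix.mulVec_sub, ← h₁, ← h₂, sub_self]
  funext a
  have h₁ := (hx (Fin.natAdd Tini a)).2
  have h₂ := (hx' (Fin.natAdd Tini a)).2
  simp only [Fin.append_right, Fin.val_natAdd] at h₁ h₂
  rw [← sub_eq_zero, h₁, h₂, ← Matrix.mulVec_sub, hdiff _ (by have := a.2; omega)]
  exact hout _

/-! ### The matrix exponential on eigenvectors -/

open scoped Matrix.Norms.Operator in
theorem hasSum_matrix_exp {ι : Type*} [Fintype ι] [DecidableEq ι] (M : Matrix ι ι ℂ) :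
    HasSum (fun n : ℕ => ((n.factorial : ℂ)⁻¹) • M ^ n) (NormedSpace.exp M) :=
  NormedSpace.exp_series_hasSum_exp' M

open scoped Matrix.Norms.Operator in
theorem map_matrix_exp {ι : Type*} [Fintype ι] [DecidableEq ι] (A : Matrix ι ι ℝ) :
    (NormedSpace.exp A).map (algebraMap ℝ ℂ) = NormedSpace.exp (A.map (algebraMap ℝ ℂ)) := by
  exact NormedSpace.map_exp (algebraMap ℝ ℂ).mapMatrix
    (continuous_id.matrix_map Complex.continuous_ofReal) A

/-- On vectors killed by `M ^ 2` the exponential is `1 + M`. -/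
theorem exp_mulVec_of_sq_eq_zero {ι : Type*} [Fintype ι] [DecidableEq ι] {M : Matrix ι ι ℂ}
    {z : ι → ℂ} (h : M *ᵥ (M *ᵥ z) = 0) : NormedSpace.exp M *ᵥ z = z + M *ᵥ z := by
  let F : Matrix ι ι ℂ →+ (ι → ℂ) :=
    { toFun := fun M => M *ᵥ z
      map_zero' := Matrix.zero_mulVec z
      map_add' := fun M M' => Matrix.add_mulVec M M' z }
  have hF : Continuous F := continuous_id.matrix_mulVec continuous_const
  have hsum := (hasSum_matrix_exp M).map F hF
  refine hsum.unique ?_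
  have := hasSum_sum_of_ne_finset_zero (L := .unconditional ℕ)
    (f := F ∘ fun n : ℕ => ((n.factorial : ℂ)⁻¹) • M ^ n) (s := Finset.range 2) ?_
  · simpa [Finset.sum_range_succ, F] using this
  · intro n hn
    obtain ⟨k, rfl⟩ : ∃ k, n = k + 2 := ⟨n - 2, by simp at hn; omega⟩
    have : M ^ (k + 2) *ᵥ z = 0 := by
      rw [pow_add, ← Matrix.mulVec_mulVec, pow_two, ← Matrix.mulVec_mulVec, h, Matrix.mulVec_zero]
    simp [F, Matrix.smul_mulVec, this]

/-- `t • M` splits into the scalar `t * l` and the commuting `t • (M - l • 1)`, whose square kills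
`z`. With `r = 0` this is the eigenvector formula; with `r ≠ 0` it shows that a Jordan chain of
length two survives exponentiation. -/
theorem exp_smul_mulVec {ι : Type*} [Fintype ι] [DecidableEq ι] {M : Matrix ι ι ℂ} (t l : ℂ)
    {z r : ι → ℂ} (h₁ : M *ᵥ z = l • z + r) (h₂ : M *ᵥ r = l • r) :
    NormedSpace.exp (t • M) *ᵥ z = Complex.exp (t * l) • (z + t • r) := by
  have hsplit : t • M = Matrix.diagonal (fun _ => t * l) + t • (M - l • 1) := by
    rw [← Matrix.smul_one_eq_diagonal]
    module
  have hcomm : Commute (Matrix.diagonal fun _ : ι => t * l) (t • (M - l • 1)) := by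
    rw [← Matrix.smul_one_eq_diagonal]
    exact (Commute.one_left _).smul_left _
  have hz : (t • (M - l • 1)) *ᵥ z = t • r := by
    rw [Matrix.smul_mulVec, Matrix.sub_mulVec, h₁, Matrix.smul_mulVec, Matrix.one_mulVec]
    simp
  have hr : (t • (M - l • 1)) *ᵥ (t • r) = 0 := by
    rw [Matrix.smul_mulVec, Matrix.sub_mulVec, Matrix.mulVec_smul, h₂, Matrix.smul_mulVec,
      Matrix.one_mulVec, smul_comm, sub_self, smul_zero]
  rw [hsplit, Matrix.exp_add_of_commute _ _ hcomm, ← Matrix.mulVec_mulVec,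
    exp_mulVec_of_sq_eq_zero (M := t • (M - l • 1)) (by rw [hz, hr]), hz, Matrix.exp_diagonal]
  funext i
  rw [Matrix.mulVec_diagonal]
  simp [Complex.exp_eq_exp_ℂ]

/-- If `l ↦ exp (t * l)` is injective on the eigenvalues of `M`, every eigenvector of `exp (t • M)`
is an eigenvector of `M`. -/
theorem exists_mulVec_eq_smul_of_exp {ι : Type*} [Fintype ι] [DecidableEq ι] {M : Matrix ι ι ℂ}
    {t : ℂ} (ht : t ≠ 0)
    (hinj : ∀ (a b : ℂ) (v w : ι → ℂ), v ≠ 0 → w ≠ 0 → M *ᵥ v = a • v → M *ᵥ w = b • w →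
      Complex.exp (t * a) = Complex.exp (t * b) → a = b)
    {μ : ℂ} {v : ι → ℂ} (hv : NormedSpace.exp (t • M) *ᵥ v = μ • v) :
    ∃ l : ℂ, M *ᵥ v = l • v := by
  let f : Module.End ℂ (ι → ℂ) := M.mulVecLin
  let W : Submodule ℂ (ι → ℂ) := Module.End.eigenspace (NormedSpace.exp (t • M)).mulVecLin μ
  have hWmem : ∀ w, w ∈ W ↔ NormedSpace.exp (t • M) *ᵥ w = μ • w := fun w => by
    simp [W]
  have hcomm : NormedSpace.exp (t • M) * M = M * NormedSpace.exp (t • M) :=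
    (((Commute.refl M).smul_left t).exp_left).eq
  have hWf : ∀ w ∈ W, f w ∈ W := by
    intro w hw
    rw [hWmem] at hw ⊢
    simp only [f, Matrix.mulVecLin_apply]
    rw [Matrix.mulVec_mulVec, hcomm, ← Matrix.mulVec_mulVec, hw, Matrix.mulVec_smul]
  have hexp : ∀ (l : ℂ) (w : ι → ℂ), w ∈ W → w ≠ 0 → M *ᵥ w = l • w →
      Complex.exp (t * l) = μ := by
    intro l w hw hw0 hl
    have h := exp_smul_mulVec t l (z := w) (r := 0) (by rw [hl, add_zero]) (by simp)
    rw [(hWmem w).1 hw, smul_zero, add_zero] at h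
    exact (smul_left_injective ℂ hw0 h).symm
  -- `M` has no nontrivial Jordan chain inside `W`: the end of a chain `w`, `r` would give `μ w = μ
  -- (w + t r)` with `μ`, `t` and `r` nonzero.
  have hss : ∀ (l : ℂ) (k : ℕ) (w : ι → ℂ), w ∈ W →
      ((f - algebraMap ℂ (Module.End ℂ (ι → ℂ)) l) ^ k) w = 0 → M *ᵥ w = l • w := by
    intro l k
    induction k with
    | zero =>
      intro w _ h
      have : w = 0 := by simpa using h
      simp [this]
    | succ k ih =>
      intro w hw h
      rw [pow_succ, Module.End.mul_apply] at h
      set r := (f - algebraMap ℂ (Module.End ℂ (ι → ℂ)) l) w with hr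
      have hr' : r = M *ᵥ w - l • w := by
        simp [hr, f, Module.algebraMap_end_apply]
      have hrW : r ∈ W := by
        rw [hr']
        exact W.sub_mem (hWf w hw) (W.smul_mem _ hw)
      have hMr := ih r hrW h
      rcases eq_or_ne r 0 with h0 | h0
      · rw [← sub_eq_zero, ← hr', h0]
      · have hμ := hexp l r hrW h0 hMr
        have h := exp_smul_mulVec t l (z := w) (r := r) (by rw [hr']; abel) hMr
        rw [(hWmem w).1 hw, hμ, smul_add, left_eq_add, smul_smul, smul_eq_zero, mul_eq_zero] at h
        have hμ0 : μ ≠ 0 := hμ ▸ Complex.exp_ne_zero _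
        exact absurd h (by tauto)
  -- Being `M`-invariant, `W` is the sum of its intersections with the generalized eigenspaces.
  have hWsup : W ≤ ⨆ l, W ⊓ f.maxGenEigenspace l := by
    have h := Submodule.inf_iSup_genEigenspace (p := W) (f := f) hWf ⊤
    have htop : ⨆ l, f.genEigenspace l ⊤ = ⊤ := Module.End.iSup_maxGenEigenspace_eq_top f
    rw [htop, inf_top_eq] at h
    exact h.le
  have hgen : ∀ (l : ℂ) (w : ι → ℂ), w ∈ W ⊓ f.maxGenEigenspace l → M *ᵥ w = l • w := by
    rintro l w ⟨hw, hl⟩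
    obtain ⟨k, hk⟩ := (Module.End.mem_maxGenEigenspace f l w).1 hl
    refine hss l k w hw ?_
    simpa [Algebra.algebraMap_eq_smul_one] using hk
  by_cases hbot : ∀ l, W ⊓ f.maxGenEigenspace l = ⊥
  · simp only [hbot, iSup_bot, le_bot_iff] at hWsup
    have : v ∈ W := (hWmem v).2 hv
    rw [hWsup, Submodule.mem_bot] at this
    exact ⟨0, by simp [this]⟩
  · push Not at hbot
    obtain ⟨l, hl⟩ := hbot
    obtain ⟨z, hz, hz0⟩ := Submodule.exists_mem_ne_zero_of_ne_bot hl
    refine ⟨l, ?_⟩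
    -- Every eigenvalue occurring in `W` exponentiates to `μ`, so by injectivity there is only one.
    have hle : ⨆ l, W ⊓ f.maxGenEigenspace l ≤ f.eigenspace l := by
      refine iSup_le fun b w hw => ?_
      rw [Module.End.mem_eigenspace_iff]
      rcases eq_or_ne w 0 with h0 | h0
      · simp [h0]
      · have hb := hgen b w hw
        have : b = l := hinj b l w z h0 hz0 hb (hgen l z hz) <| by
          rw [hexp b w hw.1 h0 hb, hexp l z hz.1 hz0 (hgen l z hz)]
        rw [← this]
        exact hb
    have := hle (hWsup ((hWmem v).2 hv))
    rwa [Module.End.mem_eigenspace_iff] at this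

/-! ### Controllability of the sampled system -/

theorem mem_spectrum_of_vecMul_eq_smul {ι : Type*} [Fintype ι] [DecidableEq ι] {M : Matrix ι ι ℂ}
    {l : ℂ} {v : ι → ℂ} (hv : v ≠ 0) (h : v ᵥ* M = l • v) : l ∈ spectrum ℂ M := by
  rw [spectrum.mem_iff, Matrix.isUnit_iff_isUnit_det, isUnit_iff_ne_zero, not_not,
    ← Matrix.exists_vecMul_eq_zero_iff]
  refine ⟨v, hv, ?_⟩
  rw [Matrix.vecMul_sub, h, Algebra.algebraMap_eq_smul_one, Matrix.vecMul_smul, Matrix.vecMul_one,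
    sub_self]

/-- Equal exponentials force `a - b = 2πik / Δt` for an integer `k`, and the sampling condition
leaves only `k = 0`. -/
theorem SamplingCondition.eq_of_exp_eq {ι : Type} [Fintype ι] [DecidableEq ι] {A : Matrix ι ι ℝ}
    {Δt : ℝ} (hΔt : 0 < Δt) (h : SamplingCondition A Δt) {a b : ℂ}
    (ha : a ∈ spectrum ℂ (A.map (algebraMap ℝ ℂ))) (hb : b ∈ spectrum ℂ (A.map (algebraMap ℝ ℂ)))
    (hab : Complex.exp (Δt * a) = Complex.exp (Δt * b)) : a = b := by
  obtain ⟨k, hk⟩ := Complex.exp_eq_exp_iff_exists_int.1 hab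
  have hre : (a - b).re = 0 := by
    have := congrArg Complex.re hk
    simp at this
    rcases this with h | h
    · simp [h]
    · exact absurd h hΔt.ne'
  have him : (a - b).im = 2 * Real.pi * k / Δt := by
    have := congrArg Complex.im hk
    simp at this
    rw [eq_div_iff hΔt.ne', Complex.sub_im]
    linarith
  rcases eq_or_ne k 0 with h0 | h0
  · refine sub_eq_zero.1 (Complex.ext hre ?_)
    simp [him, h0]
  · refine absurd ?_ (h a ha b hb hre k.natAbs (Int.natAbs_pos.2 h0))
    rw [him, abs_div, abs_mul, abs_of_pos hΔt, abs_of_pos Real.two_pi_pos, Nat.cast_natAbs,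
      Int.cast_abs]

theorem star_vecMul_map_eq_smul {ι : Type*} [Fintype ι] {A : Matrix ι ι ℝ} {l : ℂ} {v : ι → ℂ}
    (h : v ᵥ* A.map (algebraMap ℝ ℂ) = l • v) :
    star v ᵥ* A.map (algebraMap ℝ ℂ) = star l • star v := by
  funext i
  have := congrArg star (congrFun h i)
  simpa [Matrix.vecMul, dotProduct] using this

theorem vecMul_exp_smul {ι : Type*} [Fintype ι] [DecidableEq ι] {M : Matrix ι ι ℂ} (t : ℂ) {l : ℂ}
    {v : ι → ℂ} (h : v ᵥ* M = l • v) :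
    v ᵥ* NormedSpace.exp (t • M) = Complex.exp (t * l) • v := by
  have := exp_smul_mulVec (M := Mᵀ) t l (z := v) (r := 0)
    (by rw [Matrix.mulVec_transpose, h, add_zero]) (by simp)
  rwa [← Matrix.transpose_smul, Matrix.exp_transpose, Matrix.mulVec_transpose, smul_zero,
    add_zero] at this

theorem map_exp_smul {ι : Type*} [Fintype ι] [DecidableEq ι] (A : Matrix ι ι ℝ) (t : ℝ) :
    (NormedSpace.exp (t • A)).map (algebraMap ℝ ℂ) =
      NormedSpace.exp ((t : ℂ) • A.map (algebraMap ℝ ℂ)) := by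
  rw [map_matrix_exp]
  congr 1
  ext i j
  simp

open scoped Matrix.Norms.Operator in
theorem continuous_exp_smul {ι : Type*} [Fintype ι] [DecidableEq ι] (A : Matrix ι ι ℝ) :
    Continuous fun t : ℝ => NormedSpace.exp (t • A) :=
  NormedSpace.exp_continuous.comp (continuous_id.smul continuous_const)

/-- A left eigenvector of `A` is mapped by `∫₀^{Δt} e^{A t} G dt` to a multiple of `v G`. -/
theorem vecMul_discInput {ι κ : Type} [Fintype ι] [DecidableEq ι] (A : Matrix ι ι ℝ)
    (G : Matrix ι κ ℝ) (Δt : ℝ) {l : ℂ} {v : ι → ℂ}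
    (h : v ᵥ* A.map (algebraMap ℝ ℂ) = l • v) :
    v ᵥ* (discInput A G Δt).map (algebraMap ℝ ℂ) =
      (∫ t in (0 : ℝ)..Δt, Complex.exp (l * t)) • (v ᵥ* G.map (algebraMap ℝ ℂ)) := by
  funext c
  have hcont : ∀ i, Continuous fun t : ℝ => (NormedSpace.exp (t • A) * G) i c := fun i =>
    ((continuous_exp_smul A).matrix_mul continuous_const).matrix_elem i c
  -- Since `v e^{tA} = e^{lt} v`, the integrand is a scalar function of `t` times the constant `v
  -- G`.
  have hint : ∀ t : ℝ, ∑ i, v i * (((NormedSpace.exp (t • A) * G) i c : ℝ) : ℂ) =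
      Complex.exp (l * t) * (v ᵥ* G.map (algebraMap ℝ ℂ)) c := by
    intro t
    have hmap : (NormedSpace.exp (t • A) * G).map (algebraMap ℝ ℂ) =
        NormedSpace.exp ((t : ℂ) • A.map (algebraMap ℝ ℂ)) * G.map (algebraMap ℝ ℂ) := by
      rw [Matrix.map_mul, map_exp_smul]
    have := congrFun (congrArg (v ᵥ* ·) hmap) c
    simp only [← Matrix.vecMul_vecMul, vecMul_exp_smul _ h] at this
    rw [Matrix.smul_vecMul, Pi.smul_apply, smul_eq_mul, mul_comm (t : ℂ)] at this
    exact this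
  simp only [Pi.smul_apply, smul_eq_mul]
  rw [← intervalIntegral.integral_mul_const]
  simp only [← hint]
  rw [intervalIntegral.integral_finsetSum]
  · simp only [Matrix.vecMul, dotProduct, Matrix.map_apply, discInput, Matrix.of_apply,
      intervalIntegral.integral_const_mul, intervalIntegral.integral_ofReal,
      Complex.coe_algebraMap]
  · intro i _
    exact (continuous_const.mul (Complex.continuous_ofReal.comp (hcont i))).intervalIntegrable _ _

/-- For an eigenvalue `l` of `A`, the sampling condition makes `∫₀^{Δt} e^{l t} dt` nonzero. -/
theorem SamplingCondition.integral_exp_ne_zero {ι : Type} [Fintype ι] [DecidableEq ι]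
    {A : Matrix ι ι ℝ} {Δt : ℝ} (hΔt : 0 < Δt) (hs : SamplingCondition A Δt) {l : ℂ} {v : ι → ℂ}
    (hv : v ≠ 0) (h : v ᵥ* A.map (algebraMap ℝ ℂ) = l • v) :
    ∫ t in (0 : ℝ)..Δt, Complex.exp (l * t) ≠ 0 := by
  rcases eq_or_ne l 0 with rfl | hl
  · simpa using hΔt.ne'
  · intro h0
    rw [integral_exp_mul_complex hl, div_eq_zero_iff, or_iff_left hl, sub_eq_zero] at h0
    have h1 : Complex.exp (Δt * l) = 1 := by simpa [mul_comm] using h0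
    -- Zero need not be an eigenvalue, so the sampling condition cannot compare `l` with `0`. It is
    -- applied to `l` and its conjugate, an eigenvalue because `A` is real; hence `l` is real, and
    -- then `exp (Δt * l) = 1` forces `l = 0`.
    have h2 : Complex.exp (Δt * star l) = 1 := by
      have := congrArg star h1
      simpa [← Complex.exp_conj] using this
    have hreal : l = star l := hs.eq_of_exp_eq hΔt (mem_spectrum_of_vecMul_eq_smul hv h)
      (mem_spectrum_of_vecMul_eq_smul (star_ne_zero.2 hv) (star_vecMul_map_eq_smul h))
      (h1.trans h2.symm)
    obtain ⟨r, rfl⟩ := Complex.conj_eq_iff_real.1 hreal.symm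
    rw [← Complex.ofReal_mul, ← Complex.ofReal_exp, Complex.ofReal_eq_one, Real.exp_eq_one_iff,
      mul_eq_zero, or_iff_right hΔt.ne'] at h1
    exact hl (by simp [h1])

/-- **Popov–Belevitch–Hautus test**: if no left eigenvector of `M` is annihilated by `G`, then no
nonzero covector annihilates all `M ^ k * G`. -/
theorem eq_zero_of_vecMul_pow_eq_zero {ι κ : Type*} [Fintype ι] [DecidableEq ι]
    {M : Matrix ι ι ℂ} {G : Matrix ι κ ℂ}
    (hPBH : ∀ (l : ℂ) (v : ι → ℂ), v ᵥ* M = l • v → v ᵥ* G = 0 → v = 0)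
    {ξ : ι → ℂ} (hξ : ∀ k, (ξ ᵥ* M ^ k) ᵥ* G = 0) : ξ = 0 := by
  -- `U` is invariant under `z ↦ z ᵥ* M`; if nonzero it contains a left eigenvector, and the case `k
  -- = 0` says that `G` annihilates it.
  let U : Submodule ℂ (ι → ℂ) :=
    { carrier := {z | ∀ k, (z ᵥ* M ^ k) ᵥ* G = 0}
      add_mem' := fun {a b} ha hb k => by simp [Matrix.add_vecMul, ha k, hb k]
      zero_mem' := fun k => by simp
      smul_mem' := fun c z hz k => by simp [Matrix.smul_vecMul, hz k] }
  have hUM : ∀ z ∈ U, M.vecMulLinear z ∈ U := fun z hz k => by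
    have := hz (k + 1)
    rwa [pow_succ', ← Matrix.vecMul_vecMul z] at this
  by_contra hne
  have hnt : Nontrivial U := ⟨⟨⟨ξ, hξ⟩, 0, fun h => hne (congrArg Subtype.val h)⟩⟩
  obtain ⟨l, hl⟩ := Module.End.exists_eigenvalue (LinearMap.restrict M.vecMulLinear hUM)
  obtain ⟨z, hz⟩ := hl.exists_hasEigenvector
  refine hz.2 (Subtype.ext (hPBH l z ?_ ?_))
  · exact congrArg Subtype.val hz.apply_eq_smul
  · simpa using z.2 0

/-- Controllability of the continuous-time system is inherited by the sampled system. -/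
theorem controllable_of_sampling {ι κ : Type} [Fintype ι] [DecidableEq ι] {A : Matrix ι ι ℝ}
    {G : Matrix ι κ ℝ} {Δt : ℝ} (hΔt : 0 < Δt) (hs : SamplingCondition A Δt)
    (hPBH : ∀ (l : ℂ) (v : ι → ℂ), v ᵥ* A.map (algebraMap ℝ ℂ) = l • v →
      v ᵥ* G.map (algebraMap ℝ ℂ) = 0 → v = 0)
    (ξ : ι → ℝ)
    (hξ : ∀ k < Fintype.card ι, (ξ ᵥ* discState A Δt ^ k) ᵥ* discInput A G Δt = 0) : ξ = 0 := by
  have hall := vecMul_pow_eq_zero_of_lt_card _ _ ξ hξ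
  have hcast : (fun i => (ξ i : ℂ)) = 0 := by
    refine eq_zero_of_vecMul_pow_eq_zero (M := (discState A Δt).map (algebraMap ℝ ℂ))
      (G := (discInput A G Δt).map (algebraMap ℝ ℂ)) ?_ ?_
    · intro μ v hv hvG
      by_contra hv0
      -- Transposing turns left eigenvectors into the right ones that `exists_mulVec_eq_smul_of_exp`
      -- handles.
      rw [discState, map_exp_smul, ← Matrix.mulVec_transpose, ← Matrix.exp_transpose,
        Matrix.transpose_smul] at hv
      obtain ⟨l, hl⟩ := exists_mulVec_eq_smul_of_exp (Complex.ofReal_ne_zero.2 hΔt.ne')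
        (fun a b v w hv0 hw0 hv hw hab => hs.eq_of_exp_eq hΔt
          (mem_spectrum_of_vecMul_eq_smul hv0 (by rwa [← Matrix.mulVec_transpose]))
          (mem_spectrum_of_vecMul_eq_smul hw0 (by rwa [← Matrix.mulVec_transpose])) hab) hv
      rw [Matrix.mulVec_transpose] at hl
      rw [vecMul_discInput A G Δt hl, smul_eq_zero,
        or_iff_right (hs.integral_exp_ne_zero hΔt hv0 hl)] at hvG
      exact hv0 (hPBH l v hl hvG)
    · intro k
      have hc := congrArg (fun f : κ → ℝ => fun c => ((f c : ℝ) : ℂ)) (hall k)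
      have hM : ((discState A Δt).map (algebraMap ℝ ℂ)) ^ k =
          (discState A Δt ^ k).map (algebraMap ℝ ℂ) :=
        (map_pow (algebraMap ℝ ℂ).mapMatrix (discState A Δt) k).symm
      rw [hM]
      funext c
      simpa [Matrix.vecMul, dotProduct] using congrFun hc c
  funext i
  exact Complex.ofReal_eq_zero.1 (congrFun hcast i)

theorem discInput_fromCols {ι κ τ : Type} [Fintype ι] [DecidableEq ι] (A : Matrix ι ι ℝ)
    (H : Matrix ι τ ℝ) (B : Matrix ι κ ℝ) (Δt : ℝ) :
    discInput A (Matrix.fromCols H B) Δt =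
      Matrix.fromCols (discInput A H Δt) (discInput A B Δt) := by
  ext i (c | c) <;> simp [discInput, Matrix.mul_apply]

/-! ### Controllability of the traffic system -/

/-- Evaluates a column of a block lower bidiagonal matrix: block column `i` meets only block rows
`i` and `i + 1`, and the second is absent for the last vehicle. -/
theorem sum_self_or_succ {n : ℕ} {M : Type*} [AddCommMonoid M] (i : Fin n) (X Y : Fin n → M) :
    (∑ k : Fin n, if i = k then X k else if (i : ℕ) + 1 = k then Y k else 0) =
      X i + if h : (i : ℕ) + 1 < n then Y ⟨i + 1, h⟩ else 0 := by
  have hsplit : ∀ k : Fin n, (if i = k then X k else if (i : ℕ) + 1 = k then Y k else 0) =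
      (if i = k then X k else 0) + if (i : ℕ) + 1 = k then Y k else 0 := by
    intro k
    by_cases h : i = k
    · subst h
      simp
    · simp [h]
  simp only [hsplit, Finset.sum_add_distrib, Finset.sum_ite_eq, Finset.mem_univ, if_true]
  congr 1
  by_cases h : (i : ℕ) + 1 < n
  · rw [dif_pos h, Finset.sum_eq_single ⟨i + 1, h⟩]
    · simp
    · intro k _ hk
      rw [if_neg fun h' => hk (Fin.ext h'.symm)]
    · simp
  · rw [dif_neg h]
    refine Finset.sum_eq_zero fun k _ => if_neg fun h' => h ?_
    rw [h']
    exact k.2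

section

variable {n : ℕ} (S : Finset (Fin n)) (α₁ α₂ α₃ : ℝ) (v : StateIdx n → ℂ)

/-- The velocity of vehicle `k - 1` enters the dynamics of vehicle `k`; this is its coefficient in
the pairing of a covector `v` with the vector field (`0` if there is no vehicle `k`). -/
def couplingCoeff (k : ℕ) : ℂ :=
  if h : k < n then v (⟨k, h⟩, 0) + if (⟨k, h⟩ : Fin n) ∈ S then 0 else α₃ * v (⟨k, h⟩, 1) else 0

theorem vecMul_matA_spacing (i : Fin n) :
    (v ᵥ* (matA S α₁ α₂ α₃).map (algebraMap ℝ ℂ)) (i, 0) =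
      if i ∈ S then 0 else α₁ * v (i, 1) := by
  have h : (v ᵥ* (matA S α₁ α₂ α₃).map (algebraMap ℝ ℂ)) (i, 0) =
      ∑ k : Fin n, if i = k then (if k ∈ S then 0 else α₁ * v (k, 1)) else
        if (i : ℕ) + 1 = k then 0 else 0 := by
    simp only [Matrix.vecMul, dotProduct, Fintype.sum_prod_type, Fin.sum_univ_two, matA,
      Matrix.map_apply, Matrix.of_apply]
    refine Finset.sum_congr rfl fun k _ => ?_
    split_ifs <;> simp [blockS1, blockP1, blockS2, blockP2, mul_comm]
  rw [h, sum_self_or_succ]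
  simp

theorem vecMul_matA_velocity (i : Fin n) :
    (v ᵥ* (matA S α₁ α₂ α₃).map (algebraMap ℝ ℂ)) (i, 1) =
      (-v (i, 0) - if i ∈ S then 0 else α₂ * v (i, 1)) + couplingCoeff S α₃ v (i + 1) := by
  have h : (v ᵥ* (matA S α₁ α₂ α₃).map (algebraMap ℝ ℂ)) (i, 1) =
      ∑ k : Fin n, if i = k then (-v (k, 0) - if k ∈ S then 0 else α₂ * v (k, 1)) else
        if (i : ℕ) + 1 = k then (v (k, 0) + if k ∈ S then 0 else α₃ * v (k, 1)) else 0 := by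
    simp only [Matrix.vecMul, dotProduct, Fintype.sum_prod_type, Fin.sum_univ_two, matA,
      Matrix.map_apply, Matrix.of_apply]
    refine Finset.sum_congr rfl fun k _ => ?_
    split_ifs <;> simp [blockS1, blockP1, blockS2, blockP2, mul_comm]; ring
  rw [h, sum_self_or_succ]
  rfl

theorem vecMul_matB (i : S) :
    (v ᵥ* (matB S).map (algebraMap ℝ ℂ)) i = v (i, 1) := by
  simp only [Matrix.vecMul, dotProduct, matB, Matrix.map_apply, Matrix.of_apply]
  rw [Finset.sum_eq_single ((i : Fin n), (1 : Fin 2))]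
  · simp
  · intro p _ hp
    simp [hp]
  · simp

theorem vecMul_matH (η : ℝ) (h : 0 < n) (c : Fin 1) :
    (v ᵥ* (matH n η).map (algebraMap ℝ ℂ)) c = v (⟨0, h⟩, 0) + η * v (⟨0, h⟩, 1) := by
  simp only [Matrix.vecMul, dotProduct, matH, Matrix.map_apply, Matrix.of_apply,
    Fintype.sum_prod_type, Fin.sum_univ_two]
  rw [Finset.sum_eq_single ⟨0, h⟩]
  · simp [mul_comm]
  · intro k _ hk
    have : (k : ℕ) ≠ 0 := fun h' => hk (Fin.ext h')
    simp [this]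
  · simp

end

/-- The linearized traffic system passes the Hautus controllability test. -/
theorem matA_hautus {n : ℕ} (S : Finset (Fin n)) {α₁ α₂ α₃ η : ℝ} (hα₁ : α₁ ≠ 0)
    (hη : η = α₃ ∨ (η = 0 ∧ ∃ i ∈ S, (i : ℕ) = 0)) (hparam : α₁ - α₂ * α₃ + α₃ ^ 2 ≠ 0)
    {l : ℂ} {v : StateIdx n → ℂ}
    (hA : v ᵥ* (matA S α₁ α₂ α₃).map (algebraMap ℝ ℂ) = l • v)
    (hG : v ᵥ* (Matrix.fromCols (matH n η) (matB S)).map (algebraMap ℝ ℂ) = 0) : v = 0 := by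
  have hα₁' : (α₁ : ℂ) ≠ 0 := Complex.ofReal_ne_zero.2 hα₁
  have hparam' : (α₁ - α₂ * α₃ + α₃ ^ 2 : ℂ) ≠ 0 := by exact_mod_cast hparam
  have hB : ∀ i ∈ S, v (i, 1) = 0 := fun i hi => by
    rw [← vecMul_matB S v ⟨i, hi⟩]
    exact congrFun hG (.inr ⟨i, hi⟩)
  have hs : ∀ i : Fin n, (if i ∈ S then 0 else (α₁ : ℂ) * v (i, 1)) = l * v (i, 0) := fun i => by
    rw [← vecMul_matA_spacing S α₁ α₂ α₃, hA]
    rfl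
  have hv : ∀ i : Fin n, (-v (i, 0) - if i ∈ S then 0 else α₂ * v (i, 1)) +
      couplingCoeff S α₃ v (i + 1) = l * v (i, 1) := fun i => by
    rw [← vecMul_matA_velocity S α₁ α₂ α₃, hA]
    rfl
  -- The head vehicle acts as the predecessor of vehicle `0`, so annihilating `H` starts the
  -- induction. If vehicle `0` is a CAV, annihilating `B` removes the `η` term, whatever `η` is.
  have h0 : couplingCoeff S α₃ v 0 = 0 := by
    rw [couplingCoeff]
    split_ifs with h hS
    · have := congrFun hG (.inl 0)
      rw [add_zero]
      have hH := vecMul_matH v η h 0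
      rw [hB _ hS, mul_zero, add_zero] at hH
      exact hH.symm.trans this
    · have hηα : η = α₃ := by
        rcases hη with h' | ⟨-, i, hi, hi0⟩
        · exact h'
        · exact absurd ((Fin.ext hi0 : i = ⟨0, h⟩) ▸ hi) hS
      have hH := vecMul_matH v η h 0
      rw [hηα] at hH
      exact hH.symm.trans (by rw [← hηα]; exact congrFun hG (.inl 0))
    · rfl
  -- At this exceptional eigenvalue the spacing equation of each vehicle is `l` times its coupling
  -- coefficient, so all coefficients vanish without induction.
  have hres : l * α₃ = -α₁ → ∀ k, couplingCoeff S α₃ v k = 0 := by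
    intro hl k
    have hl0 : l ≠ 0 := by
      rintro rfl
      exact hα₁' (by simpa using hl.symm)
    rw [couplingCoeff]
    split_ifs with h hS
    · have := hs ⟨k, h⟩
      rw [if_pos hS] at this
      simpa [hl0] using this.symm
    · have := hs ⟨k, h⟩
      rw [if_neg hS] at this
      refine (mul_eq_zero.1 ?_).resolve_left hl0
      linear_combination -this + hl * v (⟨k, h⟩, 1)
    · rfl
  have hstep : ∀ i : Fin n, couplingCoeff S α₃ v i = 0 →
      (v (i, 0) = 0 ∧ v (i, 1) = 0) ∧ couplingCoeff S α₃ v (i + 1) = 0 := by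
    intro i hi
    have hvi := hv i
    have hsi := hs i
    rw [couplingCoeff, dif_pos i.2] at hi
    simp only [Fin.eta] at hi
    by_cases hS : i ∈ S
    · have h1 := hB i hS
      simp only [hS, if_true, add_zero, sub_zero] at hi hvi
      refine ⟨⟨hi, h1⟩, ?_⟩
      simpa [hi, h1] using hvi
    · simp only [hS, if_false] at hi hvi hsi
      -- If `v (i, 1) ≠ 0`, zero coupling and the spacing equation force the exceptional eigenvalue.
      -- By `hres` the next coupling vanishes too, and the velocity equation times `α₃` becomes `(α₁
      -- - α₂ α₃ + α₃²) v (i, 1) = 0`.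
      have h1 : v (i, 1) = 0 := by
        by_contra hne
        have hl : l * α₃ = -α₁ := by
          refine mul_right_cancel₀ hne ?_
          linear_combination hsi + l * hi
        rw [hres hl] at hvi
        refine hparam' ((mul_eq_zero.1 ?_).resolve_right hne)
        linear_combination (α₃ : ℂ) * hvi + hl * v (i, 1) + α₃ * hi
      have h2 : v (i, 0) = 0 := by simpa [h1] using hi
      refine ⟨⟨h2, h1⟩, ?_⟩
      simpa [h1, h2] using hvi
  have hall : ∀ k ≤ n, couplingCoeff S α₃ v k = 0 := by
    intro k
    induction k with
    | zero => exact fun _ => h0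
    | succ k ih => exact fun hk => (hstep ⟨k, hk⟩ (ih (by omega))).2
  funext ⟨i, c⟩
  have := (hstep i (hall i i.2.le)).1
  fin_cases c
  · exact this.1
  · exact this.2

end MixedTraffic

end

theorem proposition2 {n : ℕ} (S : Finset (Fin n)) (α₁ α₂ α₃ η Δt : ℝ)
    (hα₁ : 0 < α₁) (hα₃ : 0 < α₃) (hα₂ : α₃ < α₂)
    (hη : η = α₃ ∨ (η = 0 ∧ ∃ i ∈ S, (i : ℕ) = 0))
    (hΔt : 0 < Δt)
    (hparam : α₁ - α₂ * α₃ + α₃ ^ 2 ≠ 0)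
    (hsampling : MixedTraffic.SamplingCondition (MixedTraffic.matA S α₁ α₂ α₃) Δt)
    (T Tini N : ℕ)
    (ud : Fin T → S → ℝ) (εd : Fin T → Fin 1 → ℝ) (yd : Fin T → MixedTraffic.OutIdx S → ℝ)
    (hdata : MixedTraffic.IsTrafficTrajectory S α₁ α₂ α₃ η Δt ud εd yd)
    (hexc : MixedTraffic.PersistentlyExciting (Tini + N + 2 * n)
      (MixedTraffic.combinedInput ud εd)) :
    (∀ (uini : Fin Tini → S → ℝ) (εini : Fin Tini → Fin 1 → ℝ)
        (yini : Fin Tini → MixedTraffic.OutIdx S → ℝ)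
        (u : Fin N → S → ℝ) (ε : Fin N → Fin 1 → ℝ) (y : Fin N → MixedTraffic.OutIdx S → ℝ),
      MixedTraffic.IsTrafficTrajectory S α₁ α₂ α₃ η Δt
          (Fin.append uini u) (Fin.append εini ε) (Fin.append yini y) ↔
        MixedTraffic.InDataRange ud εd yd uini εini yini u ε y) ∧
    (2 * n ≤ Tini →
      ∀ (uini : Fin Tini → S → ℝ) (εini : Fin Tini → Fin 1 → ℝ)
        (yini : Fin Tini → MixedTraffic.OutIdx S → ℝ)
        (u : Fin N → S → ℝ) (ε : Fin N → Fin 1 → ℝ)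
        (y y' : Fin N → MixedTraffic.OutIdx S → ℝ),
        MixedTraffic.InDataRange ud εd yd uini εini yini u ε y →
        MixedTraffic.InDataRange ud εd yd uini εini yini u ε y' → y = y') := by
  have hcard : Fintype.card (MixedTraffic.StateIdx n) = 2 * n := by simp [mul_comm]
  rw [← hcard] at hexc ⊢
  have hiff : ∀ (uini : Fin Tini → S → ℝ) (εini : Fin Tini → Fin 1 → ℝ)
      (yini : Fin Tini → MixedTraffic.OutIdx S → ℝ)
      (u : Fin N → S → ℝ) (ε : Fin N → Fin 1 → ℝ) (y : Fin N → MixedTraffic.OutIdx S → ℝ),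
      MixedTraffic.IsTrafficTrajectory S α₁ α₂ α₃ η Δt
          (Fin.append uini u) (Fin.append εini ε) (Fin.append yini y) ↔
        MixedTraffic.InDataRange ud εd yd uini εini yini u ε y := by
    intro uini εini yini u ε y
    rw [MixedTraffic.inDataRange_iff]
    refine MixedTraffic.isTrajectory_iff_exists_hankel _ _ _ _ ?_ hdata hexc _ _ _
    intro ξ hξ
    refine MixedTraffic.controllable_of_sampling hΔt hsampling (fun l v hA hG =>
      MixedTraffic.matA_hautus S hα₁.ne' hη hparam hA hG) ξ ?_
    rwa [MixedTraffic.discInput_fromCols]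
  refine ⟨hiff, fun hT uini εini yini u ε y y' h h' => ?_⟩
  exact MixedTraffic.IsTrajectory.future_output_unique hT ((hiff _ _ _ _ _ _).2 h)
    ((hiff _ _ _ _ _ _).2 h')
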